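/- Let $0\le\varepsilon<1$. There are a constant $c>0$ and an $n_0\in\mathbb{N}$, both depending only on $\varepsilon$, such that the following holds for every $n\ge n_0$. Let $W$ and $M$ be disjoint sets of $n$ women and $n$ men, and let $\mu$ be a fixed perfect marriage (bijection) between $W$ and $M$, known to both Alice and Bob. Alice holds a profile $P_W$ of full preference lists of the women (a total ordering of $M$ for every $w\in W$), and Bob holds a profile $P_M$ of full preference lists of the men (a total ordering of $W$ for every $m\in M$). A pair $(w,m)\in W\times M$ blocks a perfect marriage if each of $w$ and $m$ prefers the other over their spouse, and a perfect marriage is stable if no pair blocks it. Call $\mu$ $\varepsilon$-unstable if $d(\mu)>\varepsilon n$, where $d(\mu)=\min_{\mu'}\bigl(n-|\mu\cap\mu'|\bigr)$, the minimum being over all perfect marriages $\mu'$ that are stable with respect to $P_W$ and $P_M$, and marriages being identified with their sets of couples. It is promised that $\mu$ is either stable or $\varepsilon$-unstable with respect to $P_W$ and $P_M$. Then the randomized communication complexity of determining which of the two is the case is at least $c\,n^2$, and hence is $\Omega(n^2)$. That is, for every randomized two-party communication protocol between Alice and Bob (even one with shared random coins) which, for every fixed pair $(P_W,P_M)$ that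 satisfies the promise, outputs the correct answer with probability at least $\frac23$, the number of bits exchanged, in the worst case over the pairs $(P_W,P_M)$ that satisfy the promise and over the random coins, is at least $c\,n^2$. -/

import Mathlib

open scoped ENNReal

namespace StableMarriage

/-! ### Marriage markets -/

/-- A full preference list over `M`: a (strict) total ordering of `M`, where `prefers a b` means
that `a` precedes `b` on the list. -/
structure FullPrefList (M : Type) where
  /-- `prefers a b`: `a` is preferred over `b`. -/
  prefers : M → M → Prop
  isStrictTotalOrder : IsStrictTotalOrder M prefers

/-- A profile of full preference lists for `W` over `M`: one full preference list over `M` for each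
member of `W`. -/
abbrev FullProfile (W M : Type) : Type := W → FullPrefList M

/-- A perfect marriage between `W` and `M`. -/
abbrev PerfectMarriage (W M : Type) : Type := W ≃ M

/-- `(w, m)` is a blocking pair with respect to `μ`: each of `w` and `m` prefers the other over
their spouse in `μ`. -/
def IsBlockingPair {W M : Type} (PW : FullProfile W M) (PM : FullProfile M W)
    (μ : PerfectMarriage W M) (w : W) (m : M) : Prop :=
  (PW w).prefers m (μ w) ∧ (PM m).prefers w (μ.symm m)

/-- `μ` is stable: no blocking pairs exist with respect to `μ`. -/
def IsStable {W M : Type} (PW : FullProfile W M) (PM : FullProfile M W)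
    (μ : PerfectMarriage W M) : Prop :=
  ∀ w m, ¬ IsBlockingPair PW PM μ w m

/-- The divorce distance `n - |μ ∩ μ'|` between two perfect marriages, where `n = |W| = |M|` and
`μ ∩ μ'` is the set of couples that are married in both (counted by their woman). The subtraction
does not truncate, as `|μ ∩ μ'| ≤ n`. -/
noncomputable def divorceDist {W M : Type} [Fintype W] (μ μ' : PerfectMarriage W M) : ℕ :=
  Fintype.card W - {w : W | μ w = μ' w}.ncard

/-- The divorce distance to stability: the minimum of `divorceDist μ μ'` over all stable
marriages `μ'` (at least one of which always exists). -/
noncomputable def distToStability {W M : Type} [Fintype W] (PW : FullProfile W M)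
    (PM : FullProfile M W) (μ : PerfectMarriage W M) : ℕ :=
  sInf {d : ℕ | ∃ μ' : PerfectMarriage W M, IsStable PW PM μ' ∧ d = divorceDist μ μ'}

/-- `μ` is `ε`-unstable: its divorce distance to stability is greater than `ε n`. -/
def IsEpsUnstable {W M : Type} [Fintype W] (ε : ℝ) (PW : FullProfile W M)
    (PM : FullProfile M W) (μ : PerfectMarriage W M) : Prop :=
  ε * (Fintype.card W : ℝ) < (distToStability PW PM μ : ℝ)

/-! ### Two-party communication -/

/-- A deterministic two-party communication protocol with a Boolean output, where Alice holds an
`x : X` and Bob holds a `y : Y`: a finite binary tree. At an inner node its owner sends one bit,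
which depends on the owner's input (and on the node, that is, on all bits exchanged so far), and
both parties proceed to the left child if the bit is `false` and to the right child if it is
`true`. A leaf holds the output. -/
inductive Protocol (X Y : Type) : Type where
  | leaf (out : Bool) : Protocol X Y
  | alice (send : X → Bool) (left right : Protocol X Y) : Protocol X Y
  | bob (send : Y → Bool) (left right : Protocol X Y) : Protocol X Y

namespace Protocol

variable {X Y : Type}

/-- The output of the protocol on input `(x, y)`. -/
def output : Protocol X Y → X → Y → Bool
  | leaf out, _, _ => out
  | alice send left right, x, y => bif send x then right.output x y else left.output x y
  | bob send left right, x, y => bif send y then right.output x y else left.output x y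

/-- The number of bits that are exchanged on input `(x, y)`. -/
def bits : Protocol X Y → X → Y → ℕ
  | leaf _, _, _ => 0
  | alice send left right, x, y => (bif send x then right.bits x y else left.bits x y) + 1
  | bob send left right, x, y => (bif send y then right.bits x y else left.bits x y) + 1

end Protocol

/-- A randomized protocol (with shared random coins): a probability distribution over deterministic
protocols. This includes protocols with private coins, since fixing the coins of both parties
leaves a deterministic protocol. -/
abbrev RandomizedProtocol (X Y : Type) : Type := PMF (Protocol X Y)

namespace RandomizedProtocol

variable {X Y : Type}

/-- The probability that the randomized protocol outputs `b` on the fixed input `(x, y)`. -/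
noncomputable def prob (P : RandomizedProtocol X Y) (x : X) (y : Y) (b : Bool) : ℝ≥0∞ :=
  P.toOuterMeasure {p | p.output x y = b}

/-- `P` distinguishes the inputs with `Yes x y` from those with `No x y`: on every fixed input that
satisfies the promise `Yes x y ∨ No x y`, its output is correct with probability at least `2/3`. -/
def Decides (P : RandomizedProtocol X Y) (Yes No : X → Y → Prop) : Prop :=
  ∀ x y, (Yes x y → 2 / 3 ≤ P.prob x y true) ∧ (No x y → 2 / 3 ≤ P.prob x y false)

/-- The communication cost of `P` on the inputs that satisfy `D`: the number of bits exchanged for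
the worst such input and the worst outcome of the coins. -/
noncomputable def cost (P : RandomizedProtocol X Y) (D : X → Y → Prop) : ℕ∞ :=
  ⨆ (x : X) (y : Y) (_ : D x y) (p ∈ P.support), (p.bits x y : ℕ∞)

end RandomizedProtocol

/-- The randomized communication complexity of determining which of `Yes x y` and `No x y` holds,
under the promise that one of them does: the lowest cost, over the inputs that satisfy the promise,
of any randomized protocol for this task. -/
noncomputable def randomizedCC {X Y : Type} (Yes No : X → Y → Prop) : ℕ∞ :=
  ⨅ (P : RandomizedProtocol X Y) (_ : P.Decides Yes No), P.cost fun x y => Yes x y ∨ No x y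

end StableMarriage

open StableMarriage

/-!
Set disjointness on a ground set of order `n ^ 2` reduces to the problem, without communication,
and randomized protocols for set disjointness need a linear number of bits.

*Reduction.* Take `2 * k < (1 - ε) * n`. Alice's set `x` of pairs `(i, j)` says which men of a
first group of `k` men each of `k` women prefers over her spouse, and Bob's set `y` says which of
these women each of these men prefers over his spouse; all other men like their spouses best. Thus
a blocking pair of `μ` is the same as an element of `x ∩ y`. The `n - 2 * k` remaining couples form
a chain: each woman of the chain likes the man before her, and he takes her as his second choice,
so a couple that survives in a stable marriage forces the couple before it to survive. The head of
the chain stands in the same relation to the spouses of the `k` women. So if a single couple of the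
chain survives, then all the `k` women keep their spouses, and an element of `x ∩ y` blocks
(`ne_of_not_disjoint`). That the distance to stability is a minimum over a nonempty set is the
Gale–Shapley theorem (`exists_isStable`).

*Disjointness.* By `map_acceptsWithin_le`, it suffices that each rectangle that is not
exponentially small under a distribution of disjoint pairs has at least `3 / 4` as much mass under a
distribution of pairs that meet in one element (`corruption_bound`). The disjoint pair is drawn by
splitting the ground set at random into `S` and `Sᶜ`, and taking random subsets `x ⊆ S` and
`y ⊆ Sᶜ`. Given `S`, the two sides of the rectangle are independent, and by the level-1 inequality
(`subsetAvg_mul_sum_bias_sq_le`) a side of mass `p` has total squared bias at most `2 log (1 / p)`.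
Hence most coordinates are nearly unbiased on both sides, and for these the rectangle has about the
same mass with the coordinate in both sets as with it in at most one (`one_coordinate`).
-/

namespace StableMarriage

section

open Finset

/-! ### Linear functionals on the accepted inputs of a protocol -/

section Protocols

variable {X Y : Type} {α β : Type*}

open Classical in
/-- The indicator that the protocol outputs `true` on `(x, y)` after at most `d` bits. The bound on
the bits makes the counting of leaves insensitive to the depth of the tree off the inputs of
interest. -/
noncomputable def Protocol.acceptsWithin (p : Protocol X Y) (d : ℕ) (x : X) (y : Y) : ℝ :=
  if p.output x y = true ∧ p.bits x y ≤ d then 1 else 0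

lemma Protocol.acceptsWithin_alice_zero (send : X → Bool) (l r : Protocol X Y) (x : X) (y : Y) :
    (Protocol.alice send l r).acceptsWithin 0 x y = 0 := by
  simp [acceptsWithin, bits]

lemma Protocol.acceptsWithin_bob_zero (send : Y → Bool) (l r : Protocol X Y) (x : X) (y : Y) :
    (Protocol.bob send l r).acceptsWithin 0 x y = 0 := by
  simp [acceptsWithin, bits]

lemma Protocol.acceptsWithin_alice_succ (send : X → Bool) (l r : Protocol X Y) (d : ℕ) (x : X)
    (y : Y) : (Protocol.alice send l r).acceptsWithin (d + 1) x y =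
      if send x then r.acceptsWithin d x y else l.acceptsWithin d x y := by
  cases h : send x <;> simp [acceptsWithin, bits, output, h]

lemma Protocol.acceptsWithin_bob_succ (send : Y → Bool) (l r : Protocol X Y) (d : ℕ) (x : X)
    (y : Y) : (Protocol.bob send l r).acceptsWithin (d + 1) x y =
      if send y then r.acceptsWithin d x y else l.acceptsWithin d x y := by
  cases h : send y <;> simp [acceptsWithin, bits, output, h]

/-- The inputs that a protocol accepts within `d` bits split into at most `2 ^ d` rectangles, so
a linear functional that is at most `e` on rectangles is at most `2 ^ d * e` on their indicator. -/
lemma map_acceptsWithin_le (Λ : (α → β → ℝ) →ₗ[ℝ] ℝ) {e : ℝ} (he : 0 ≤ e)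
    (hΛ : ∀ (f : α → ℝ) (g : β → ℝ), (∀ x, 0 ≤ f x ∧ f x ≤ 1) → (∀ y, 0 ≤ g y ∧ g y ≤ 1) →
      Λ (fun x y => f x * g y) ≤ e)
    (a : α → X) (b : β → Y) (p : Protocol X Y) :
    ∀ (d : ℕ) (f : α → ℝ) (g : β → ℝ), (∀ x, 0 ≤ f x ∧ f x ≤ 1) → (∀ y, 0 ≤ g y ∧ g y ≤ 1) →
      Λ (fun x y => f x * g y * p.acceptsWithin d (a x) (b y)) ≤ 2 ^ d * e := by
  have hzero : Λ (fun _ _ => 0) = 0 := Λ.map_zero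
  induction p with
  | leaf out =>
    intro d f g hf hg
    have h2 : e ≤ 2 ^ d * e := le_mul_of_one_le_left he (one_le_pow₀ one_le_two)
    cases out
    · simpa [Protocol.acceptsWithin, Protocol.output, hzero] using he.trans h2
    · simpa [Protocol.acceptsWithin, Protocol.output, Protocol.bits] using (hΛ f g hf hg).trans h2
  | alice send l r ihl ihr =>
    intro d f g hf hg
    cases d with
    | zero => simpa [Protocol.acceptsWithin_alice_zero, hzero] using he
    | succ d =>
      have e1 : (fun x y => f x * g y *
          (Protocol.alice send l r).acceptsWithin (d + 1) (a x) (b y)) =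
          (fun x y => (if send (a x) then f x else 0) * g y * r.acceptsWithin d (a x) (b y)) +
          (fun x y => (if send (a x) then 0 else f x) * g y *
            l.acceptsWithin d (a x) (b y)) := by
        funext x y
        cases h : send (a x) <;> simp [Protocol.acceptsWithin_alice_succ, h]
      have h1 := ihr d (fun x => if send (a x) then f x else 0) g
        (fun x => by split_ifs <;> simp [hf x]) hg
      have h2 := ihl d (fun x => if send (a x) then 0 else f x) g
        (fun x => by split_ifs <;> simp [hf x]) hg
      rw [e1, map_add, pow_succ]
      linarith
  | bob send l r ihl ihr =>
    intro d f g hf hg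
    cases d with
    | zero => simpa [Protocol.acceptsWithin_bob_zero, hzero] using he
    | succ d =>
      have e1 : (fun x y => f x * g y *
          (Protocol.bob send l r).acceptsWithin (d + 1) (a x) (b y)) =
          (fun x y => f x * (if send (b y) then g y else 0) * r.acceptsWithin d (a x) (b y)) +
          (fun x y => f x * (if send (b y) then 0 else g y) *
            l.acceptsWithin d (a x) (b y)) := by
        funext x y
        cases h : send (b y) <;> simp [Protocol.acceptsWithin_bob_succ, h]
      have h1 := ihr d f (fun y => if send (b y) then g y else 0) hf
        (fun y => by split_ifs <;> simp [hg y])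
      have h2 := ihl d f (fun y => if send (b y) then 0 else g y) hf
        (fun y => by split_ifs <;> simp [hg y])
      rw [e1, map_add, pow_succ]
      linarith

lemma RandomizedProtocol.prob_ne_top (P : RandomizedProtocol X Y) (x : X) (y : Y) (o : Bool) :
    P.prob x y o ≠ ∞ := by
  refine ne_top_of_le_ne_top ENNReal.one_ne_top ?_
  rw [← P.tsum_coe, prob, P.toOuterMeasure_apply]
  exact ENNReal.tsum_le_tsum fun p => Set.indicator_le_self _ _ p

lemma RandomizedProtocol.hasSum_prob (P : RandomizedProtocol X Y) (x : X) (y : Y) (o : Bool) :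
    HasSum (fun p => (P p).toReal * if p.output x y = o then 1 else 0)
      (P.prob x y o).toReal := by
  have e : P.prob x y o = ∑' p, {p : Protocol X Y | p.output x y = o}.indicator P p :=
    P.toOuterMeasure_apply _
  have hle := P.prob_ne_top x y o
  rw [e] at hle ⊢
  have h := ENNReal.hasSum_toReal hle
  rw [← ENNReal.tsum_toReal_eq (fun p => ENNReal.ne_top_of_tsum_ne_top hle p)] at h
  convert h using 2 with p
  by_cases hp : p.output x y = o <;> simp [hp]

lemma RandomizedProtocol.hasSum_coe (P : RandomizedProtocol X Y) :
    HasSum (fun p => (P p).toReal) 1 := by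
  have h := ENNReal.hasSum_toReal (P.tsum_coe_ne_top)
  rwa [← ENNReal.tsum_toReal_eq P.apply_ne_top, P.tsum_coe, ENNReal.toReal_one] at h

lemma RandomizedProtocol.prob_true_add_prob_false (P : RandomizedProtocol X Y) (x : X) (y : Y) :
    (P.prob x y true).toReal + (P.prob x y false).toReal = 1 := by
  refine ((P.hasSum_prob x y true).add (P.hasSum_prob x y false)).unique ?_
  convert P.hasSum_coe using 2 with p
  cases p.output x y <;> simp

/-- The average of `map_acceptsWithin_le` over the coins of a randomized protocol. -/
lemma map_prob_le [Finite α] [Finite β] (Λ : (α → β → ℝ) →ₗ[ℝ] ℝ) {e : ℝ} (he : 0 ≤ e)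
    (hΛ : ∀ (f : α → ℝ) (g : β → ℝ), (∀ x, 0 ≤ f x ∧ f x ≤ 1) → (∀ y, 0 ≤ g y ∧ g y ≤ 1) →
      Λ (fun x y => f x * g y) ≤ e)
    (a : α → X) (b : β → Y) (P : RandomizedProtocol X Y) {d : ℕ}
    (hd : ∀ x y, ∀ p ∈ P.support, p.bits (a x) (b y) ≤ d) :
    Λ (fun x y => (P.prob (a x) (b y) true).toReal) ≤ 2 ^ d * e := by
  have : Fintype α := Fintype.ofFinite α
  have : Fintype β := Fintype.ofFinite β
  have h1 : HasSum (fun p => fun (x : α) (y : β) =>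
      (P p).toReal * if p.output (a x) (b y) = true then (1 : ℝ) else 0)
      (fun x y => (P.prob (a x) (b y) true).toReal) :=
    Pi.hasSum.2 fun x => Pi.hasSum.2 fun y => P.hasSum_prob (a x) (b y) true
  have h2 := h1.map Λ Λ.continuous_of_finiteDimensional
  have h3 := P.hasSum_coe.mul_right (2 ^ d * e)
  rw [one_mul] at h3
  refine hasSum_le (fun p => ?_) h2 h3
  by_cases hp : p ∈ P.support
  · have e1 : (fun (x : α) (y : β) =>
        (P p).toReal * if p.output (a x) (b y) = true then (1 : ℝ) else 0) =
        (P p).toReal • fun x y => 1 * 1 * p.acceptsWithin d (a x) (b y) := by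
      funext x y
      simp [Protocol.acceptsWithin, hd x y p hp]
    simp only [Function.comp_apply]
    rw [e1, map_smul, smul_eq_mul]
    exact mul_le_mul_of_nonneg_left (map_acceptsWithin_le Λ he hΛ a b p d (fun _ => 1)
      (fun _ => 1) (by simp) (by simp)) ENNReal.toReal_nonneg
  · have : P p = 0 := by simpa using hp
    simp only [Function.comp_apply, this, ENNReal.toReal_zero, zero_mul]
    exact Λ.map_zero.le

end Protocols

/-! ### Biases of a function on the subsets of a set -/

section Bias

variable {ι : Type*}

/-- The mean of `f x` over a uniformly random subset `x` of `S`. -/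
noncomputable def subsetAvg (f : Finset ι → ℝ) (S : Finset ι) : ℝ :=
  (∑ x ∈ S.powerset, f x) / 2 ^ #S

lemma subsetAvg_nonneg {f : Finset ι → ℝ} (hf : ∀ x, 0 ≤ f x) (S : Finset ι) :
    0 ≤ subsetAvg f S :=
  div_nonneg (sum_nonneg fun x _ => hf x) (by positivity)

lemma subsetAvg_mono {f g : Finset ι → ℝ} (h : ∀ x, f x ≤ g x) (S : Finset ι) :
    subsetAvg f S ≤ subsetAvg g S :=
  div_le_div_of_nonneg_right (sum_le_sum fun x _ => h x) (by positivity)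

lemma subsetAvg_const_mul (c : ℝ) (f : Finset ι → ℝ) (S : Finset ι) :
    subsetAvg (fun x => c * f x) S = c * subsetAvg f S := by
  simp only [subsetAvg, ← mul_sum, mul_div_assoc]

lemma subsetAvg_add (f g : Finset ι → ℝ) (S : Finset ι) :
    subsetAvg (fun x => f x + g x) S = subsetAvg f S + subsetAvg g S := by
  simp only [subsetAvg, sum_add_distrib, add_div]

lemma subsetAvg_sum {κ : Type*} (s : Finset κ) (f : κ → Finset ι → ℝ) (S : Finset ι) :
    subsetAvg (fun x => ∑ j ∈ s, f j x) S = ∑ j ∈ s, subsetAvg (f j) S := by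
  simp only [subsetAvg]
  rw [sum_comm, sum_div]

variable [DecidableEq ι]

/-- The character of the `i`-th coordinate: `-1` if `i ∈ x`, and `1` otherwise. -/
def parity (i : ι) (x : Finset ι) : ℝ := if i ∈ x then -1 else 1

/-- The mean of the `i`-th character over a random subset `x` of `S` drawn with density proportional
to `f`, which for an indicator `f` is the probability that `i ∉ x` minus the probability that
`i ∈ x`. It is `0` if `f` vanishes on the subsets of `S`. -/
noncomputable def bias (f : Finset ι → ℝ) (S : Finset ι) (i : ι) : ℝ :=
  subsetAvg (fun x => f x * parity i x) S / subsetAvg f S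

lemma subsetAvg_insert (f : Finset ι → ℝ) {i : ι} {T : Finset ι} (hi : i ∉ T) :
    subsetAvg f (insert i T) =
      (subsetAvg f T + subsetAvg (fun x => f (insert i x)) T) / 2 := by
  simp only [subsetAvg, sum_powerset_insert hi, card_insert_of_notMem hi, pow_succ]
  field_simp

lemma subsetAvg_mul_parity_insert (f : Finset ι → ℝ) {i : ι} {T : Finset ι} (hi : i ∉ T) :
    subsetAvg (fun x => f x * parity i x) (insert i T) =
      (subsetAvg f T - subsetAvg (fun x => f (insert i x)) T) / 2 := by
  rw [subsetAvg_insert _ hi, sub_eq_add_neg]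
  congr 2
  · unfold subsetAvg
    congr 1
    refine sum_congr rfl fun x hx => ?_
    have : i ∉ x := fun h => hi (mem_powerset.1 hx h)
    simp [parity, this]
  · rw [← neg_one_mul, ← subsetAvg_const_mul]
    simp [parity]

/-- The averages of `f` over the subsets of `insert i T` without `i` and with `i`, in terms of the
overall average and of the bias. This holds also where the bias is a junk `0 / 0`. -/
lemma subsetAvg_eq_mul_bias {f : Finset ι → ℝ} (hf : ∀ x, 0 ≤ f x) {i : ι} {T : Finset ι}
    (hi : i ∉ T) :
    subsetAvg f T = subsetAvg f (insert i T) * (1 + bias f (insert i T) i) ∧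
    subsetAvg (fun x => f (insert i x)) T =
      subsetAvg f (insert i T) * (1 - bias f (insert i T) i) := by
  have h0 := subsetAvg_nonneg hf T
  have h1 := subsetAvg_nonneg (fun x => hf (insert i x)) T
  have e := subsetAvg_insert f hi
  have e' := subsetAvg_mul_parity_insert f hi
  have key : subsetAvg f (insert i T) * bias f (insert i T) i =
      (subsetAvg f T - subsetAvg (fun x => f (insert i x)) T) / 2 := by
    rw [← e', bias]
    by_cases h : subsetAvg f (insert i T) = 0
    · rw [h, zero_mul, e']
      linarith
    · field_simp
  constructor <;> linarith

lemma abs_bias_le_one {f : Finset ι → ℝ} (hf : ∀ x, 0 ≤ f x) (S : Finset ι) (i : ι) :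
    |bias f S i| ≤ 1 := by
  have h0 := subsetAvg_nonneg hf S
  rw [bias, abs_div, abs_of_nonneg h0]
  refine div_le_one_of_le₀ (abs_le.2 ⟨?_, ?_⟩) h0
  · rw [← neg_one_mul, ← subsetAvg_const_mul]
    refine subsetAvg_mono (fun x => ?_) S
    have := hf x
    unfold parity; split_ifs <;> linarith
  · refine subsetAvg_mono (fun x => ?_) S
    have := hf x
    unfold parity; split_ifs <;> linarith

/-- The moment generating function of a Rademacher sum is sub-Gaussian. -/
lemma subsetAvg_exp_sum_le (a : ι → ℝ) (S : Finset ι) :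
    subsetAvg (fun x => Real.exp (∑ i ∈ S, a i * parity i x)) S ≤
      Real.exp ((∑ i ∈ S, a i ^ 2) / 2) := by
  have e : ∑ x ∈ S.powerset, Real.exp (∑ i ∈ S, a i * parity i x) =
      ∏ i ∈ S, (Real.exp (-a i) + Real.exp (a i)) := by
    rw [prod_add]
    refine sum_congr rfl fun x hx => ?_
    rw [Real.exp_sum, ← prod_sdiff (mem_powerset.1 hx), mul_comm]
    congr 1
    · exact prod_congr rfl fun i hi => by simp [parity, hi]
    · exact prod_congr rfl fun i hi => by simp [parity, (mem_sdiff.1 hi).2]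
  rw [subsetAvg, e, ← prod_const, ← prod_div_distrib, sum_div, Real.exp_sum]
  refine prod_le_prod (fun i _ => by positivity) fun i _ => ?_
  rw [add_comm, ← Real.cosh_eq]
  exact Real.cosh_le_exp_half_sq (a i)

/-- The level-1 inequality: if `f` has mean `p`, its squared biases add up to at most
`2 log (1 / p)`. Jensen's inequality for `exp` is applied under the density `f / p` to the linear
form `l` whose coefficients are the biases themselves, so that the mean of `l` is
`m = ∑ bias²`. This gives
`p * exp m ≤ 𝔼 exp l ≤ exp (m / 2)`. -/
lemma subsetAvg_mul_sum_bias_sq_le {f : Finset ι → ℝ} (hf : ∀ x, 0 ≤ f x) (hf' : ∀ x, f x ≤ 1)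
    (S : Finset ι) :
    subsetAvg f S * ∑ i ∈ S, bias f S i ^ 2 ≤ 2 * Real.negMulLog (subsetAvg f S) := by
  rcases (subsetAvg_nonneg hf S).eq_or_lt with h0 | hp
  · simp [← h0]
  set p := subsetAvg f S with hpdef
  set m := ∑ i ∈ S, bias f S i ^ 2 with hm
  let l : Finset ι → ℝ := fun x => ∑ i ∈ S, bias f S i * parity i x
  have hl : subsetAvg (fun x => f x * l x) S = p * m := by
    have : (fun x => f x * l x) = fun x => ∑ i ∈ S, bias f S i * (f x * parity i x) := by
      funext x
      simp only [l, mul_sum]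
      exact sum_congr rfl fun i _ => by ring
    rw [this, subsetAvg_sum, hm, mul_sum]
    refine sum_congr rfl fun i _ => ?_
    rw [subsetAvg_const_mul, sq, mul_left_comm, bias, ← hpdef]
    field_simp
  have h1 : p * Real.exp m ≤ subsetAvg (fun x => Real.exp (l x)) S := by
    have h2 : subsetAvg (fun x => Real.exp m * ((1 - m) * f x + f x * l x)) S ≤
        subsetAvg (fun x => Real.exp (l x)) S := by
      refine subsetAvg_mono (fun x => ?_) S
      have e : Real.exp (l x) = Real.exp m * Real.exp (l x - m) := by
        rw [← Real.exp_add]; ring_nf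
      -- the tangent of `exp` at the mean `m` of `l` is what Jensen's inequality comes down to
      have t := Real.add_one_le_exp (l x - m)
      rw [e]
      refine mul_le_mul_of_nonneg_left ?_ (Real.exp_pos _).le
      have := Real.exp_pos (l x - m)
      nlinarith [hf x, hf' x]
    rw [subsetAvg_const_mul, subsetAvg_add, subsetAvg_const_mul, hl, ← hpdef] at h2
    linarith
  have h3 := h1.trans (subsetAvg_exp_sum_le (fun i => bias f S i) S)
  rw [← hm] at h3
  have h4 : Real.log p + m ≤ m / 2 := by
    have := Real.log_le_log (by positivity) h3
    rwa [Real.log_mul hp.ne' (Real.exp_pos _).ne', Real.log_exp, Real.log_exp] at this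
  rw [Real.negMulLog]
  nlinarith

/-- With `1 ± a` and `1 ± b` proportional to the masses of the two sides of a rectangle on which a
coordinate is absent or present, the mass `(1 - a) * (1 - b)` with the coordinate in both sets is
comparable to the mass with it in at most one, up to a penalty that is quadratic in the biases. The
constant `7 / 16` may be anything below `1 / 2`; the larger it is, the more penalty is needed. -/
lemma one_coordinate {a b : ℝ} (ha : |a| ≤ 1) (hb : |b| ≤ 1) :
    7 / 16 * ((1 + b) + (1 + a)) ≤
      (1 - a) * (1 - b) + 16 * ((1 + b) * a ^ 2 + (1 + a) * b ^ 2) := by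
  obtain ⟨ha1, -⟩ := abs_le.1 ha
  obtain ⟨hb1, -⟩ := abs_le.1 hb
  -- In terms of `s = 2 + a + b` and `r = (1 + a) * (1 + b) ≤ s ^ 2 / 4`, the claim reads
  -- `0 ≤ 4 + 217 / 16 * s - r * (63 - 16 * s)`; it suffices to check `r = s ^ 2 / 4`, or `r = 0`.
  have hs : 0 ≤ 2 + a + b := by linarith
  have hr : 0 ≤ (1 + a) * (1 + b) := mul_nonneg (by linarith) (by linarith)
  have hcubic : 0 ≤ 4 + 217 / 16 * (2 + a + b) - 63 / 4 * (2 + a + b) ^ 2 +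
      4 * (2 + a + b) ^ 3 := by
    nlinarith [mul_nonneg hs (sq_nonneg (2 + a + b - 2.08)), sq_nonneg (2 + a + b - 2.08)]
  rcases le_total (2 + a + b) (63 / 16) with h | h
  · nlinarith [mul_nonneg (sq_nonneg (a - b)) (sub_nonneg.2 h)]
  · nlinarith [mul_nonneg hr (sub_nonneg.2 h)]

end Bias

/-! ### Rectangles under the disjoint and the meeting distribution -/

section Disjointness

variable {ι : Type*}

lemma sum_powerset_mul_sum_powerset (f g : Finset ι → ℝ) (S T : Finset ι) :
    ∑ x ∈ S.powerset, ∑ y ∈ T.powerset, f x * g y =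
      subsetAvg f S * subsetAvg g T * 2 ^ (#S + #T) := by
  rw [← sum_mul_sum, subsetAvg, subsetAvg, pow_add]
  field_simp

variable [Fintype ι]

/-- Jensen's inequality for the concave function `negMulLog`, with uniform weights. -/
lemma sum_negMulLog_le {z : Finset ι → ℝ} (hz : ∀ S, 0 ≤ z S) :
    (∑ S, Real.negMulLog (z S)) / 2 ^ Fintype.card ι ≤
      Real.negMulLog ((∑ S, z S) / 2 ^ Fintype.card ι) := by
  have := Real.concaveOn_negMulLog.le_map_sum (t := (univ : Finset (Finset ι)))
    (w := fun _ => ((2 : ℝ) ^ Fintype.card ι)⁻¹) (p := z) (fun _ _ => by positivity)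
    (by simp) (fun S _ => hz S)
  simpa [← mul_sum, div_eq_inv_mul] using this

variable [DecidableEq ι]

/-- The mean of `h x y` over a random disjoint pair: `S` is a uniformly random set, and `x` and `y`
are independent uniformly random subsets of `S` and `Sᶜ`. -/
noncomputable def disjointMean (h : Finset ι → Finset ι → ℝ) : ℝ :=
  (∑ S : Finset ι, ∑ x ∈ S.powerset, ∑ y ∈ Sᶜ.powerset, h x y) / 4 ^ Fintype.card ι

/-- The mean of `h x y` over a random pair of sets that meet in exactly one element: a uniformly
random `i` is added to both sets of a random disjoint pair of subsets of `{i}ᶜ`, which is drawn as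
in `disjointMean`. -/
noncomputable def meetingMean (h : Finset ι → Finset ι → ℝ) : ℝ :=
  (∑ i : ι, ∑ T ∈ ({i}ᶜ : Finset ι).powerset, ∑ x ∈ T.powerset, ∑ y ∈ (insert i T)ᶜ.powerset,
    h (insert i x) (insert i y)) / (Fintype.card ι * 4 ^ (Fintype.card ι - 1))

lemma disjointMean_mul (f g : Finset ι → ℝ) :
    disjointMean (fun x y => f x * g y) =
      (∑ S : Finset ι, subsetAvg f S * subsetAvg g Sᶜ) / 2 ^ Fintype.card ι := by
  have : (4 : ℝ) ^ Fintype.card ι = 2 ^ Fintype.card ι * 2 ^ Fintype.card ι := by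
    rw [← mul_pow]; norm_num
  simp only [disjointMean, sum_powerset_mul_sum_powerset, card_add_card_compl, ← sum_mul]
  rw [this]
  field_simp

lemma card_mul_meetingMean_mul [Nonempty ι] (f g : Finset ι → ℝ) :
    Fintype.card ι * meetingMean (fun x y => f x * g y) =
      (∑ i : ι, ∑ T ∈ ({i}ᶜ : Finset ι).powerset, subsetAvg (fun x => f (insert i x)) T *
        subsetAvg (fun y => g (insert i y)) (insert i T)ᶜ) / 2 ^ (Fintype.card ι - 1) := by
  have hn : (Fintype.card ι : ℝ) ≠ 0 := by exact_mod_cast Fintype.card_ne_zero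
  have h4 : (4 : ℝ) ^ (Fintype.card ι - 1) =
      2 ^ (Fintype.card ι - 1) * 2 ^ (Fintype.card ι - 1) := by
    rw [← mul_pow]; norm_num
  have e : ∑ i : ι, ∑ T ∈ ({i}ᶜ : Finset ι).powerset, ∑ x ∈ T.powerset,
      ∑ y ∈ (insert i T)ᶜ.powerset, f (insert i x) * g (insert i y) =
      (∑ i : ι, ∑ T ∈ ({i}ᶜ : Finset ι).powerset, subsetAvg (fun x => f (insert i x)) T *
        subsetAvg (fun y => g (insert i y)) (insert i T)ᶜ) * 2 ^ (Fintype.card ι - 1) := by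
    simp only [sum_mul]
    refine sum_congr rfl fun i _ => sum_congr rfl fun T hT => ?_
    have hi : i ∉ T := fun h => by simpa using mem_powerset.1 hT h
    rw [sum_powerset_mul_sum_powerset (fun x => f (insert i x)) (fun y => g (insert i y))]
    have := card_add_card_compl (insert i T)
    rw [card_insert_of_notMem hi] at this
    congr 2
    omega
  rw [meetingMean, e, h4]
  field_simp

/-- The sets without `i` and the sets with `i` are paired by inserting `i`. -/
lemma sum_finset_eq_sum_insert (F : Finset ι → ℝ) (i : ι) :
    ∑ S, F S = ∑ T ∈ ({i}ᶜ : Finset ι).powerset, (F T + F (insert i T)) := by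
  have : (univ : Finset (Finset ι)) = (insert i ({i}ᶜ : Finset ι)).powerset := by
    rw [← powerset_univ]
    congr 1
    ext j
    simp
  rw [this, sum_powerset_insert (by simp), sum_add_distrib]

section Rectangle

variable {f g : Finset ι → ℝ}

/-- The contribution of the single coordinate `i` to the comparison of `meetingMean` with
`disjointMean` on a rectangle. Coordinate `i` is biased on Alice's side if `i ∈ S`, and on Bob's
side otherwise, and `one_coordinate` combines the two sets `S = T` and `S = insert i T`. -/
lemma sum_le_sum_insert (hf : ∀ x, 0 ≤ f x) (hg : ∀ y, 0 ≤ g y) (i : ι) :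
    ∑ S : Finset ι, subsetAvg f S * subsetAvg g Sᶜ *
        (7 / 16 - 16 * if i ∈ S then bias f S i ^ 2 else bias g Sᶜ i ^ 2) ≤
      ∑ T ∈ ({i}ᶜ : Finset ι).powerset, subsetAvg (fun x => f (insert i x)) T *
        subsetAvg (fun y => g (insert i y)) (insert i T)ᶜ := by
  rw [sum_finset_eq_sum_insert _ i]
  refine sum_le_sum fun T hT => ?_
  have hi : i ∉ T := fun h => by simpa using mem_powerset.1 hT h
  have hi' : i ∉ (insert i T)ᶜ := by simp
  have hTc : Tᶜ = insert i (insert i T)ᶜ := by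
    ext j
    by_cases hj : j = i <;> simp [hj, hi]
  obtain ⟨f0, f1⟩ := subsetAvg_eq_mul_bias hf hi
  obtain ⟨g0, g1⟩ := subsetAvg_eq_mul_bias hg hi'
  rw [← hTc] at g0 g1
  rw [if_neg hi, if_pos (mem_insert_self i T), f0, f1, g0, g1]
  have hA := subsetAvg_nonneg hf (insert i T)
  have hB := subsetAvg_nonneg hg Tᶜ
  have key := mul_le_mul_of_nonneg_left (one_coordinate (abs_bias_le_one hf (insert i T) i)
    (abs_bias_le_one hg Tᶜ i)) (mul_nonneg hA hB)
  linarith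

/-- On the rectangle `f ⊗ g`, the biases of all coordinates together are bounded by the information
`log (1 / p)` that membership in the rectangle reveals, given `S`. -/
lemma mul_sum_bias_sq_le (hf : ∀ x, 0 ≤ f x) (hf' : ∀ x, f x ≤ 1) (hg : ∀ y, 0 ≤ g y)
    (hg' : ∀ y, g y ≤ 1) (S : Finset ι) :
    subsetAvg f S * subsetAvg g Sᶜ *
        ∑ i, (if i ∈ S then bias f S i ^ 2 else bias g Sᶜ i ^ 2) ≤
      2 * Real.negMulLog (subsetAvg f S * subsetAvg g Sᶜ) := by
  have e : ∑ i, (if i ∈ S then bias f S i ^ 2 else bias g Sᶜ i ^ 2) =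
      ∑ i ∈ S, bias f S i ^ 2 + ∑ i ∈ Sᶜ, bias g Sᶜ i ^ 2 := by
    rw [← sum_add_sum_compl S]
    congr 1
    · exact sum_congr rfl fun i hi => if_pos hi
    · exact sum_congr rfl fun i hi => if_neg (mem_compl.1 hi)
  rw [e, Real.negMulLog_mul]
  have h1 := mul_le_mul_of_nonneg_left (subsetAvg_mul_sum_bias_sq_le hf hf' S)
    (subsetAvg_nonneg hg Sᶜ)
  have h2 := mul_le_mul_of_nonneg_left (subsetAvg_mul_sum_bias_sq_le hg hg' Sᶜ)
    (subsetAvg_nonneg hf S)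
  linarith

/-- The sum of `sum_le_sum_insert` over all coordinates, with the biases bounded by the logarithm of
the mass of the whole rectangle. -/
lemma rectangle_bound [Nonempty ι] (hf : ∀ x, 0 ≤ f x) (hf' : ∀ x, f x ≤ 1) (hg : ∀ y, 0 ≤ g y)
    (hg' : ∀ y, g y ≤ 1) :
    Fintype.card ι * (7 / 8 * disjointMean (fun x y => f x * g y)) -
        64 * Real.negMulLog (disjointMean (fun x y => f x * g y)) ≤
      Fintype.card ι * meetingMean (fun x y => f x * g y) := by
  have hz : ∀ S, 0 ≤ subsetAvg f S * subsetAvg g Sᶜ := fun S =>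
    mul_nonneg (subsetAvg_nonneg hf S) (subsetAvg_nonneg hg Sᶜ)
  have h1 := sum_le_sum fun i (_ : i ∈ (univ : Finset ι)) => sum_le_sum_insert hf hg i
  have h2 : ∑ i : ι, ∑ S : Finset ι, subsetAvg f S * subsetAvg g Sᶜ *
        (7 / 16 - 16 * if i ∈ S then bias f S i ^ 2 else bias g Sᶜ i ^ 2) =
      7 / 16 * Fintype.card ι * (∑ S, subsetAvg f S * subsetAvg g Sᶜ) -
      16 * ∑ S, subsetAvg f S * subsetAvg g Sᶜ *
        ∑ i, (if i ∈ S then bias f S i ^ 2 else bias g Sᶜ i ^ 2) := by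
    rw [sum_comm, mul_sum, mul_sum, ← sum_sub_distrib]
    refine sum_congr rfl fun S _ => ?_
    rw [← mul_sum, sum_sub_distrib, ← mul_sum]
    simp
    ring
  have h3 := sum_le_sum fun S (_ : S ∈ (univ : Finset (Finset ι))) =>
    mul_sum_bias_sq_le hf hf' hg hg' S
  rw [← mul_sum] at h3
  have h4 := sum_negMulLog_le hz
  rw [card_mul_meetingMean_mul, disjointMean_mul]
  have hpow : (2 : ℝ) ^ Fintype.card ι = 2 * 2 ^ (Fintype.card ι - 1) := by
    rw [← pow_succ', Nat.sub_add_cancel Fintype.card_pos]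
  have hpos : (0 : ℝ) < 2 ^ (Fintype.card ι - 1) := by positivity
  set Z := ∑ S : Finset ι, subsetAvg f S * subsetAvg g Sᶜ
  rw [le_div_iff₀ hpos]
  rw [hpow] at h4 ⊢
  have h5 := (div_le_iff₀ (by positivity)).1 h4
  have e : Z / (2 * 2 ^ (Fintype.card ι - 1)) * 2 ^ (Fintype.card ι - 1) = Z / 2 := by
    field_simp
  rw [h2] at h1
  linear_combination h1 + 16 * h3 + 32 * h5 + 7 / 8 * Fintype.card ι * e

/-- Razborov's corruption bound: a rectangle that is not exponentially small under the distribution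
of disjoint pairs has at least `3 / 4` as much mass under that of the pairs that meet. The
factor `3 / 4` exceeds the ratio `1 / 2` of the error `1 / 3` to the success probability `2 / 3` of
a protocol. -/
lemma corruption_bound [Nonempty ι] (hf : ∀ x, 0 ≤ f x) (hf' : ∀ x, f x ≤ 1) (hg : ∀ y, 0 ≤ g y)
    (hg' : ∀ y, g y ≤ 1) :
    3 / 4 * disjointMean (fun x y => f x * g y) - meetingMean (fun x y => f x * g y) ≤
      Real.exp (-(Fintype.card ι / 512)) := by
  have hn : (0 : ℝ) < Fintype.card ι := by exact_mod_cast Fintype.card_pos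
  have h := rectangle_bound hf hf' hg hg'
  have hU : 0 ≤ meetingMean (fun x y => f x * g y) := by
    refine div_nonneg ?_ (by positivity)
    exact sum_nonneg fun _ _ => sum_nonneg fun _ _ => sum_nonneg fun _ _ => sum_nonneg fun _ _ =>
      mul_nonneg (hf _) (hg _)
  set D := disjointMean (fun x y => f x * g y)
  have hE := Real.exp_pos (-(Fintype.card ι / 512 : ℝ))
  rcases le_total D (Real.exp (-(Fintype.card ι / 512))) with hD | hD
  · linarith
  · have hlog := (Real.le_log_iff_exp_le (hE.trans_le hD)).2 hD
    have : 64 * Real.negMulLog D ≤ Fintype.card ι * (1 / 8 * D) := by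
      rw [Real.negMulLog]
      nlinarith [hE.trans_le hD]
    have : Fintype.card ι * (3 / 4 * D - meetingMean (fun x y => f x * g y)) ≤ 0 := by linarith
    have := nonpos_of_mul_nonpos_right this hn
    linarith

end Rectangle

/-! ### The lower bound for disjointness -/

lemma isLinearMap_disjointMean : IsLinearMap ℝ (disjointMean (ι := ι)) where
  map_add h h' := by simp only [disjointMean, Pi.add_apply, sum_add_distrib, add_div]
  map_smul c h := by
    simp only [disjointMean, Pi.smul_apply, smul_eq_mul, ← mul_sum, mul_div_assoc]

lemma isLinearMap_meetingMean : IsLinearMap ℝ (meetingMean (ι := ι)) where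
  map_add h h' := by simp only [meetingMean, Pi.add_apply, sum_add_distrib, add_div]
  map_smul c h := by
    simp only [meetingMean, Pi.smul_apply, smul_eq_mul, ← mul_sum, mul_div_assoc]

lemma le_disjointMean {h : Finset ι → Finset ι → ℝ} {c : ℝ}
    (hc : ∀ x y, Disjoint x y → c ≤ h x y) : c ≤ disjointMean h := by
  have e : disjointMean (fun _ _ : Finset ι => c) = c := by
    have := disjointMean_mul (fun _ : Finset ι => c) (fun _ => 1)
    simp only [mul_one] at this
    rw [this]
    simp [subsetAvg, Fintype.card_finset]
  rw [← e]
  refine div_le_div_of_nonneg_right ?_ (by positivity)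
  refine sum_le_sum fun S _ => sum_le_sum fun x hx => sum_le_sum fun y hy => hc x y ?_
  exact disjoint_compl_right.mono (mem_powerset.1 hx) (mem_powerset.1 hy)

lemma meetingMean_le [Nonempty ι] {h : Finset ι → Finset ι → ℝ} {c : ℝ}
    (hc : ∀ x y, ¬ Disjoint x y → h x y ≤ c) : meetingMean h ≤ c := by
  have hn : (Fintype.card ι : ℝ) ≠ 0 := by exact_mod_cast Fintype.card_ne_zero
  have e : meetingMean (fun _ _ : Finset ι => c) = c := by
    have := card_mul_meetingMean_mul (fun _ : Finset ι => c) (fun _ => 1)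
    simp only [mul_one] at this
    refine mul_left_cancel₀ hn (this.trans ?_)
    simp [subsetAvg, card_compl]
    field_simp
  rw [← e]
  refine div_le_div_of_nonneg_right ?_ (by positivity)
  refine sum_le_sum fun i _ => sum_le_sum fun T _ => sum_le_sum fun x _ => sum_le_sum fun y _ =>
    hc _ _ (not_disjoint_iff.2 ⟨i, mem_insert_self _ _, mem_insert_self _ _⟩)

/-- The randomized lower bound for set disjointness, in a form that can be transferred along the
reductions `a` and `b`: a protocol that decides whether `x` and `y` are disjoint from `a x` and
`b y` has to exchange a number `d` of bits that is linear in the size of the ground set. -/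
theorem disjointness_bits [Nonempty ι] {X Y : Type} (a : Finset ι → X) (b : Finset ι → Y)
    (P : RandomizedProtocol X Y) {d : ℕ}
    (htrue : ∀ x y, Disjoint x y → 2 / 3 ≤ P.prob (a x) (b y) true)
    (hfalse : ∀ x y, ¬ Disjoint x y → 2 / 3 ≤ P.prob (a x) (b y) false)
    (hd : ∀ x y, ∀ p ∈ P.support, p.bits (a x) (b y) ≤ d) :
    (1 : ℝ) / 6 ≤ 2 ^ d * Real.exp (-(Fintype.card ι / 512)) := by
  have hreal : ∀ x y o, 2 / 3 ≤ P.prob x y o → (2 : ℝ) / 3 ≤ (P.prob x y o).toReal := by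
    intro x y o h
    simpa using ENNReal.toReal_mono (P.prob_ne_top x y o) h
  have h1 := map_prob_le ((3 / 4 : ℝ) • isLinearMap_disjointMean.mk' (disjointMean (ι := ι)) -
    isLinearMap_meetingMean.mk' (meetingMean (ι := ι))) (Real.exp_pos (-(Fintype.card ι / 512))).le
    (fun f g hf hg => corruption_bound (fun x => (hf x).1) (fun x => (hf x).2)
      (fun y => (hg y).1) (fun y => (hg y).2)) a b P hd
  have h2 : 2 / 3 ≤ disjointMean fun x y => (P.prob (a x) (b y) true).toReal :=
    le_disjointMean fun x y h => hreal _ _ _ (htrue x y h)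
  have h3 : (meetingMean fun x y => (P.prob (a x) (b y) true).toReal) ≤ 1 / 3 :=
    meetingMean_le fun x y h => by
      have := P.prob_true_add_prob_false (a x) (b y)
      linarith [hreal _ _ _ (hfalse x y h)]
  simp only [LinearMap.sub_apply, LinearMap.smul_apply, IsLinearMap.mk'_apply, smul_eq_mul] at h1
  linarith

end Disjointness

end

/-! ### Preference lists -/

namespace FullPrefList

variable {M : Type}

lemma prefers_trans (L : FullPrefList M) {a b c : M} (hab : L.prefers a b)
    (hbc : L.prefers b c) : L.prefers a c :=
  L.isStrictTotalOrder.trans a b c hab hbc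

lemma not_prefers_self (L : FullPrefList M) (a : M) : ¬ L.prefers a a :=
  L.isStrictTotalOrder.irrefl a

lemma prefers_asymm (L : FullPrefList M) {a b : M} (hab : L.prefers a b) : ¬ L.prefers b a :=
  fun hba => L.not_prefers_self a (L.prefers_trans hab hba)

lemma prefers_or_prefers (L : FullPrefList M) {a b : M} (h : a ≠ b) :
    L.prefers a b ∨ L.prefers b a := by
  by_contra! h'
  exact h (L.isStrictTotalOrder.trichotomous a b h'.1 h'.2)

/-- The list that is sorted by a rank, lowest first, with ties broken by the order of `M`. -/
def ofRank [LinearOrder M] (r : M → ℕ) : FullPrefList M where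
  prefers a b := toLex (r a, a) < toLex (r b, b)
  isStrictTotalOrder :=
    { trichotomous := fun a b h h' => by
        have := le_antisymm (not_lt.1 h') (not_lt.1 h)
        exact (Prod.mk.inj (toLex.injective this)).2
      irrefl := fun a => lt_irrefl _
      trans := fun a b c => lt_trans }

lemma prefers_ofRank_of_lt [LinearOrder M] {r : M → ℕ} {a b : M} (h : r a < r b) :
    (ofRank r).prefers a b :=
  Prod.Lex.toLex_lt_toLex.2 (Or.inl h)

lemma le_of_prefers_ofRank [LinearOrder M] {r : M → ℕ} {a b : M}
    (h : (ofRank r).prefers a b) : r a ≤ r b := by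
  rcases Prod.Lex.toLex_lt_toLex.1 h with h | h
  · exact le_of_lt h
  · exact h.1.le

lemma exists_forall_prefers [Finite M] (L : FullPrefList M) {s : Set M} (hs : s.Nonempty) :
    ∃ a ∈ s, ∀ b ∈ s, b ≠ a → L.prefers a b := by
  have := L.isStrictTotalOrder
  obtain ⟨a, ha, hmin⟩ := (Finite.wellFounded_of_trans_of_irrefl L.prefers).has_min s hs
  exact ⟨a, ha, fun b hb hne => (L.prefers_or_prefers hne).resolve_left (hmin b hb)⟩

end FullPrefList

/-! ### Existence of stable marriages -/

section GaleShapley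

variable {W M : Type}

/-- `m` is the best man for `w` among those whose pairs with `w` are not in the set `R` of
rejected pairs. -/
def IsFavourite (PW : FullProfile W M) (R : Set (W × M)) (w : W) (m : M) : Prop :=
  (w, m) ∉ R ∧ ∀ m', (w, m') ∉ R → m' ≠ m → (PW w).prefers m m'

/-- Every rejection `(w, m)` in `R` is justified: `m` prefers over `w` some woman whose favourite,
given `R`, is `m`. -/
def IsJustified (PW : FullProfile W M) (PM : FullProfile M W) (R : Set (W × M)) : Prop :=
  ∀ w m, (w, m) ∈ R → ∃ w', IsFavourite PW R w' m ∧ (PM m).prefers w' w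

lemma IsFavourite.unique {PW : FullProfile W M} {R : Set (W × M)} {w : W} {m m' : M}
    (h : IsFavourite PW R w m) (h' : IsFavourite PW R w m') : m = m' := by
  by_contra hne
  exact (PW w).prefers_asymm (h.2 m' h'.1 (Ne.symm hne)) (h'.2 m h.1 hne)

lemma IsFavourite.insert {PW : FullProfile W M} {R : Set (W × M)} {w w₀ : W} {m m₀ : M}
    (h : IsFavourite PW R w m) (hne : w ≠ w₀) :
    IsFavourite PW (insert (w₀, m₀) R) w m :=
  ⟨by simp [hne, h.1], fun m' hm' hne' => h.2 m' (fun h' => hm' (Or.inr h')) hne'⟩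

/-- The step of deferred acceptance: of two women with the same favourite, he may reject the one
that he likes less. -/
lemma IsJustified.insert {PW : FullProfile W M} {PM : FullProfile M W} {R : Set (W × M)}
    (hR : IsJustified PW PM R) {w₁ w₂ : W} {m : M} (h₁ : IsFavourite PW R w₁ m)
    (h₂ : IsFavourite PW R w₂ m) (h : (PM m).prefers w₁ w₂) :
    IsJustified PW PM (insert (w₂, m) R) := by
  have hne : w₁ ≠ w₂ := by
    rintro rfl
    exact (PM m).not_prefers_self _ h
  rintro w m' (hw | hw)
  · obtain ⟨rfl, rfl⟩ := Prod.mk.inj hw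
    exact ⟨w₁, h₁.insert hne, h⟩
  · obtain ⟨w', hw', hp⟩ := hR w m' hw
    by_cases he : w' = w₂
    · subst he
      obtain rfl := h₂.unique hw'
      exact ⟨w₁, h₁.insert hne, (PM m).prefers_trans h hp⟩
    · exact ⟨w', hw'.insert he, hp⟩

/-- The Gale–Shapley theorem. In place of running deferred acceptance, a maximal justified set of
rejections is taken; by maximality, distinct women have distinct favourites. -/
theorem exists_isStable [Finite W] (e : W ≃ M) (PW : FullProfile W M) (PM : FullProfile M W) :
    ∃ μ : PerfectMarriage W M, IsStable PW PM μ := by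
  have : Finite M := Finite.of_equiv W e
  obtain ⟨R, hR⟩ := (Set.toFinite {R | IsJustified PW PM R}).exists_maximal
    ⟨∅, fun w m h => h.elim⟩
  have hRJ : IsJustified PW PM R := hR.prop
  -- If every man rejected `w`, then each would be the favourite of some woman other than `w`, and
  -- there are too few of these.
  have hex : ∀ w, ∃ m, IsFavourite PW R w m := by
    intro w
    by_contra! hw
    have hall : ∀ m, (w, m) ∈ R := by
      by_contra! hne
      obtain ⟨m, hm, hmin⟩ := (PW w).exists_forall_prefers (s := {m | (w, m) ∉ R}) hne
      exact hw m ⟨hm, hmin⟩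
    choose v hv _ using fun m => hRJ w m (hall m)
    have hinj : Function.Injective (v ∘ e) := by
      intro a b hab
      refine e.injective ((hv (e a)).unique ?_)
      have : v (e a) = v (e b) := hab
      rw [this]
      exact hv (e b)
    obtain ⟨a, ha⟩ := Finite.surjective_of_injective hinj w
    exact hw (e a) (ha ▸ hv (e a))
  choose b hb using hex
  have hnot : ∀ w₁ w₂, b w₁ = b w₂ → ¬ (PM (b w₁)).prefers w₁ w₂ := by
    intro w₁ w₂ h hp
    have h₂ : IsFavourite PW R w₂ (b w₁) := h ▸ hb w₂
    exact h₂.1 (hR.le_of_ge (hRJ.insert (hb w₁) h₂ hp) (Set.subset_insert _ _)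
      (Set.mem_insert _ _))
  have hinj : Function.Injective b := by
    intro w₁ w₂ h
    by_contra hne
    rcases (PM (b w₁)).prefers_or_prefers hne with hp | hp
    · exact hnot w₁ w₂ h hp
    · exact hnot w₂ w₁ h.symm (h ▸ hp)
  have hbij : Function.Bijective b := by
    refine ⟨hinj, fun m => ?_⟩
    obtain ⟨w, hw⟩ := Finite.surjective_of_injective (e.symm.injective.comp hinj) (e.symm m)
    exact ⟨w, e.symm.injective hw⟩
  refine ⟨Equiv.ofBijective b hbij, fun w m hblock => ?_⟩
  obtain ⟨h₁, h₂⟩ := hblock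
  have h₁ : (PW w).prefers m (b w) := h₁
  have hmR : (w, m) ∈ R := by
    by_contra hm
    refine (PW w).prefers_asymm h₁ ((hb w).2 m hm ?_)
    rintro rfl
    exact (PW w).not_prefers_self _ h₁
  obtain ⟨w', hw', hp⟩ := hRJ w m hmR
  have : (Equiv.ofBijective b hbij).symm m = w' := by
    rw [Equiv.symm_apply_eq]
    exact hw'.unique (hb w')
  rw [this] at h₂
  exact (PM m).prefers_asymm hp h₂

end GaleShapley

/-! ### Reduction from disjointness -/

section Reduction

variable {n : ℕ} (k : ℕ) (x y : Finset (Fin k × Fin k))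

/-- In the reduction, the couples of `μ` are numbered from `0` to `n - 1`, and `WomanLikes k x p q`
says that woman `p` prefers man `q` over her spouse, man `p`. The women below `k` have these wishes
read off from Alice's set `x`, the women from `k` to `2 * k - 1` have none, woman `2 * k` likes the
first `k` men, and each later woman likes the man before her spouse. -/
def WomanLikes (p q : ℕ) : Prop :=
  (∃ i j : Fin k, p = i ∧ q = k + j ∧ (i, j) ∈ x) ∨ (p = 2 * k ∧ q < k) ∨ (2 * k < p ∧ q + 1 = p)

/-- Man `q` prefers woman `p` over his spouse, woman `q`. Only the men from `k` to `2 * k - 1` have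
such wishes, which are read off from Bob's set `y`. -/
def ManLikes (q p : ℕ) : Prop :=
  ∃ i j : Fin k, p = i ∧ q = k + j ∧ (i, j) ∈ y

/-- Woman `p` is the second choice, directly after his spouse, of man `q`: woman `2 * k` for the
first `k` men, and the next woman for each man from `2 * k` on. The remaining men have no such
choice. -/
def IsConsolation (q p : ℕ) : Prop :=
  (q < k ∧ p = 2 * k) ∨ (2 * k ≤ q ∧ p = q + 1)

open Classical in
/-- The place of man `q` on the list of woman `p`, up to ties. -/
noncomputable def womanRank (p q : ℕ) : ℕ :=
  if WomanLikes k x p q then 0 else if q = p then 1 else 2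

open Classical in
/-- The place of woman `p` on the list of man `q`, up to ties. -/
noncomputable def manRank (q p : ℕ) : ℕ :=
  if ManLikes k y q p then 0 else if p = q then 1 else if IsConsolation k q p then 2 else 3

/-- Alice's profile: men are numbered by their spouses in `μ`. -/
noncomputable def womenProfile (μ : PerfectMarriage (Fin n) (Fin n)) :
    FullProfile (Fin n) (Fin n) :=
  fun w => .ofRank fun m => womanRank k x w (μ.symm m)

/-- Bob's profile: men are numbered by their spouses in `μ`. -/
noncomputable def menProfile (μ : PerfectMarriage (Fin n) (Fin n)) :
    FullProfile (Fin n) (Fin n) :=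
  fun m => .ofRank fun w => manRank k y (μ.symm m) w

variable {k x y} {μ μ' : PerfectMarriage (Fin n) (Fin n)}

lemma womanRank_of_likes {p q : ℕ} (h : WomanLikes k x p q) : womanRank k x p q = 0 := by
  simp [womanRank, h]

lemma not_womanLikes_self (p : ℕ) : ¬ WomanLikes k x p p := by
  rintro (⟨i, j, h, h', -⟩ | h | h) <;> omega

lemma womanRank_self (p : ℕ) : womanRank k x p p = 1 := by
  simp [womanRank, not_womanLikes_self]

lemma womanLikes_of_rank_le {p q : ℕ} (h : womanRank k x p q ≤ womanRank k x p p) (hne : q ≠ p) :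
    WomanLikes k x p q := by
  by_contra h'
  simp [womanRank, h', hne, not_womanLikes_self] at h

lemma manLikes_of_rank_le {p q : ℕ} (h : manRank k y q p ≤ manRank k y q q) (hne : p ≠ q) :
    ManLikes k y q p := by
  by_contra h'
  have h1 : ¬ ManLikes k y q q := by
    rintro ⟨i, j, h, h', -⟩
    omega
  unfold manRank at h
  split_ifs at h <;> simp_all

/-- Each blocking pair of `μ` is a wish of both sides, hence an element of `x ∩ y`. -/
lemma isStable_of_disjoint (h : Disjoint x y) :
    IsStable (womenProfile k x μ) (menProfile k y μ) μ := by
  rintro w m ⟨h1, h2⟩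
  have hne : (μ.symm m : ℕ) ≠ w := by
    intro he
    have : m = μ w := by rw [← Fin.ext he, μ.apply_symm_apply]
    subst this
    exact FullPrefList.not_prefers_self _ _ h1
  have h1 := FullPrefList.le_of_prefers_ofRank h1
  have h2 := FullPrefList.le_of_prefers_ofRank h2
  rw [μ.symm_apply_apply] at h1
  obtain ⟨i, j, hi, hj, hy⟩ := manLikes_of_rank_le h2 hne.symm
  rcases womanLikes_of_rank_le h1 hne with ⟨i', j', hi', hj', hx⟩ | h | h
  · obtain rfl : i = i' := Fin.ext (by omega)
    obtain rfl : j = j' := Fin.ext (by omega)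
    exact Finset.disjoint_left.1 h hx hy
  · omega
  · omega

/-- If woman `p` keeps her spouse, then each man `q` that she prefers over him has a wife `r` whom
he ranks no lower than `p`. -/
lemma rank_wife_le_of_likes (hμ' : IsStable (womenProfile k x μ) (menProfile k y μ) μ')
    {p q r : Fin n} (hp : μ' p = μ p) (hpq : WomanLikes k x p q) (hr : μ' r = μ q) :
    manRank k y q r ≤ manRank k y q p := by
  by_contra! hlt
  refine hμ' p (μ q) ⟨FullPrefList.prefers_ofRank_of_lt ?_, FullPrefList.prefers_ofRank_of_lt ?_⟩
  · rw [hp, μ.symm_apply_apply, μ.symm_apply_apply, womanRank_of_likes hpq,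
      womanRank_self]
    exact one_pos
  · rwa [← hr, μ'.symm_apply_apply, hr, μ.symm_apply_apply]

/-- If a woman keeps her spouse and likes a man whose second choice she is, then this man has to
keep his spouse as well. -/
lemma married_of_consolation (hμ' : IsStable (womenProfile k x μ) (menProfile k y μ) μ')
    {p q : Fin n} (hp : μ' p = μ p) (hpq : WomanLikes k x p q) (hc : IsConsolation k q p) :
    μ' q = μ q := by
  set r := μ'.symm (μ q)
  have hr : μ' r = μ q := by simp [r]
  have hle := rank_wife_le_of_likes hμ' hp hpq hr
  have hno : ∀ s, ¬ ManLikes k y q s := by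
    rintro s ⟨i, j, -, h, -⟩
    rcases hc with hc | hc <;> omega
  have hqp : (q : ℕ) ≠ p := by
    rcases hc with hc | hc <;> omega
  by_cases hrq : (r : ℕ) = q
  · rwa [Fin.ext hrq] at hr
  · have hrc : IsConsolation k q r := by
      by_contra hrc
      simp [manRank, hno, hrq, hrc, hc, hqp.symm] at hle
    have : r = p := Fin.ext (by rcases hc with hc | hc <;> rcases hrc with hrc | hrc <;> omega)
    rw [this, hp] at hr
    exact absurd (congrArg Fin.val (μ.injective hr)) hqp.symm

/-- If `x` meets `y`, then a stable marriage keeps no couple from `2 * k` on. Otherwise, going down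
from that couple, couple `2 * k` would be kept, then so would the first `k` couples, and then a pair
in `x ∩ y` would block. -/
lemma ne_of_not_disjoint (hk : 2 * k < n) (h : ¬ Disjoint x y)
    (hμ' : IsStable (womenProfile k x μ) (menProfile k y μ) μ') :
    ∀ p : Fin n, 2 * k ≤ p → μ' p ≠ μ p := by
  have hbase : μ' ⟨2 * k, hk⟩ ≠ μ ⟨2 * k, hk⟩ := by
    intro hp
    have hA : ∀ q : Fin n, (q : ℕ) < k → μ' q = μ q := fun q hq =>
      married_of_consolation hμ' hp (Or.inr (Or.inl ⟨rfl, hq⟩)) (Or.inl ⟨hq, rfl⟩)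
    obtain ⟨⟨i, j⟩, hx, hy⟩ := Finset.not_disjoint_iff.1 h
    let p : Fin n := ⟨i, by omega⟩
    let q : Fin n := ⟨k + j, by omega⟩
    have hle := rank_wife_le_of_likes (p := p) (q := q) (r := μ'.symm (μ q)) hμ' (hA p i.2)
      (Or.inl ⟨i, j, rfl, rfl, hx⟩) (by simp)
    have hpq : ManLikes k y q p := ⟨i, j, rfl, rfl, hy⟩
    have hlike : ManLikes k y q (μ'.symm (μ q)) := by
      by_contra hn
      unfold manRank at hle
      rw [if_pos hpq, if_neg hn] at hle
      split_ifs at hle <;> omega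
    obtain ⟨i', j', hi', -, -⟩ := hlike
    have h1 := hA (μ'.symm (μ q)) (by omega)
    rw [μ'.apply_symm_apply] at h1
    have h2 := congrArg Fin.val (μ.injective h1)
    have h3 : (q : ℕ) = k + j := rfl
    omega
  have hind : ∀ p, 2 * k ≤ p → ∀ hpn : p < n, μ' ⟨p, hpn⟩ ≠ μ ⟨p, hpn⟩ := by
    intro p hp
    induction p, hp using Nat.le_induction with
    | base => exact fun _ => hbase
    | succ p hp ih =>
      intro hpn he
      exact ih (by omega) (married_of_consolation hμ' (q := ⟨p, by omega⟩) he
        (Or.inr (Or.inr ⟨Nat.lt_succ_of_le hp, rfl⟩)) (Or.inr ⟨hp, rfl⟩))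
  exact fun p hp => hind p hp p.2

lemma isEpsUnstable_of_not_disjoint {ε : ℝ} (hk : 2 * (k : ℝ) < (1 - ε) * n) (hε : 0 ≤ ε)
    (h : ¬ Disjoint x y) : IsEpsUnstable ε (womenProfile k x μ) (menProfile k y μ) μ := by
  have hkn : 2 * k < n := by
    have : 2 * (k : ℝ) < n := hk.trans_le (by nlinarith [(Nat.cast_nonneg n : (0 : ℝ) ≤ n)])
    exact_mod_cast this
  have hle : n - 2 * k ≤ distToStability (womenProfile k x μ) (menProfile k y μ) μ := by
    obtain ⟨μ', hμ'⟩ := exists_isStable μ (womenProfile k x μ) (menProfile k y μ)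
    refine le_csInf ⟨_, μ', hμ', rfl⟩ ?_
    rintro _ ⟨μ', hμ', rfl⟩
    have hsub : {w | μ w = μ' w} ⊆ ((↑) : Fin n → ℕ) ⁻¹' Set.Iio (2 * k) := by
      intro w hw
      by_contra hlt
      exact ne_of_not_disjoint hkn h hμ' w (not_lt.1 hlt) hw.symm
    have hcard : {w | μ w = μ' w}.ncard ≤ 2 * k := by
      rw [← Set.ncard_image_of_injective _ Fin.val_injective]
      calc _ ≤ (Set.Iio (2 * k)).ncard :=
            Set.ncard_le_ncard (Set.image_subset_iff.2 hsub) (Set.finite_Iio _)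
        _ = 2 * k := by simp [Set.ncard_eq_toFinset_card']
    rw [divorceDist, Fintype.card_fin]
    omega
  have hle' : (n : ℝ) - 2 * k ≤ distToStability (womenProfile k x μ) (menProfile k y μ) μ := by
    have : n ≤ distToStability (womenProfile k x μ) (menProfile k y μ) μ + 2 * k := by omega
    have : (n : ℝ) ≤ distToStability (womenProfile k x μ) (menProfile k y μ) μ + 2 * k := by
      exact_mod_cast this
    linarith
  rw [IsEpsUnstable, Fintype.card_fin]
  linarith

end Reduction

/-! ### Communication complexity -/

lemma div_le_of_one_sixth_le {N d : ℕ} (hN : 2048 ≤ N)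
    (h : (1 : ℝ) / 6 ≤ 2 ^ d * Real.exp (-(N / 512))) : (N : ℝ) / 1024 ≤ d := by
  have hN' : (2048 : ℝ) ≤ N := by exact_mod_cast hN
  have h2 : (2 : ℝ) ^ d ≤ Real.exp d := by
    rw [← Real.exp_one_pow]
    exact pow_le_pow_left₀ zero_le_two (by linarith [Real.add_one_le_exp (1 : ℝ)]) d
  have h3 : (1 : ℝ) / 6 ≤ Real.exp (d - N / 512) := by
    rw [sub_eq_add_neg, Real.exp_add]
    exact h.trans (mul_le_mul_of_nonneg_right h2 (Real.exp_pos _).le)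
  by_contra! hlt
  have h4 : Real.exp (d - N / 512) ≤ Real.exp (-2) := Real.exp_le_exp.2 (by linarith)
  have h5 : Real.exp (-2) * Real.exp 2 = 1 := by rw [← Real.exp_add]; simp
  have h6 : (6 : ℝ) < Real.exp 2 := by
    have := Real.exp_one_gt_d9
    have e : Real.exp 2 = Real.exp 1 * Real.exp 1 := by rw [← Real.exp_add]; norm_num
    rw [e]
    nlinarith
  nlinarith [Real.exp_pos (-2)]

lemma sq_div_le_of_cost_le {ε : ℝ} (hε : 0 ≤ ε) {n k : ℕ} (hk : 2 * (k : ℝ) < (1 - ε) * n)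
    (hk' : 46 ≤ k)
    (μ : PerfectMarriage (Fin n) (Fin n))
    (P : RandomizedProtocol (FullProfile (Fin n) (Fin n)) (FullProfile (Fin n) (Fin n)))
    (hP : P.Decides (fun PW PM => IsStable PW PM μ) (fun PW PM => IsEpsUnstable ε PW PM μ)) {d : ℕ}
    (hd : P.cost (fun PW PM => IsStable PW PM μ ∨ IsEpsUnstable ε PW PM μ) ≤ d) :
    (k : ℝ) ^ 2 / 1024 ≤ d := by
  have : NeZero k := ⟨by omega⟩
  have hpromise : ∀ x y : Finset (Fin k × Fin k),
      IsStable (womenProfile k x μ) (menProfile k y μ) μ ∨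
        IsEpsUnstable ε (womenProfile k x μ) (menProfile k y μ) μ := fun x y => by
    by_cases h : Disjoint x y
    · exact Or.inl (isStable_of_disjoint h)
    · exact Or.inr (isEpsUnstable_of_not_disjoint hk hε h)
  have key := disjointness_bits (ι := Fin k × Fin k) (fun x => womenProfile k x μ)
    (fun y => menProfile k y μ) P (d := d)
    (fun x y h => (hP _ _).1 (isStable_of_disjoint h))
    (fun x y h => (hP _ _).2 (isEpsUnstable_of_not_disjoint hk hε h))
    (fun x y p hp => by
      have h : ((p.bits (womenProfile k x μ) (menProfile k y μ) : ℕ) : ℕ∞) ≤ d :=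
        le_trans (le_iSup₂_of_le (womenProfile k x μ) (menProfile k y μ)
          (le_iSup₂_of_le (hpromise x y) p (le_iSup (fun _ : p ∈ P.support =>
            ((p.bits (womenProfile k x μ) (menProfile k y μ) : ℕ) : ℕ∞)) hp))) hd
      exact_mod_cast h)
  have hcard : Fintype.card (Fin k × Fin k) = k * k := by simp
  rw [hcard] at key
  have := div_le_of_one_sixth_le (by nlinarith) key
  rw [sq]
  exact_mod_cast this

end StableMarriage

theorem theorem4 (ε : ℝ) (hε0 : 0 ≤ ε) (hε1 : ε < 1) :
    ∃ c : ℝ, 0 < c ∧ ∃ n₀ : ℕ, ∀ n : ℕ, n₀ ≤ n → ∀ μ : PerfectMarriage (Fin n) (Fin n),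
      ENNReal.ofReal (c * (n : ℝ) ^ 2) ≤
        (randomizedCC
          (fun (PW : FullProfile (Fin n) (Fin n)) (PM : FullProfile (Fin n) (Fin n)) =>
            IsStable PW PM μ)
          (fun (PW : FullProfile (Fin n) (Fin n)) (PM : FullProfile (Fin n) (Fin n)) =>
            IsEpsUnstable ε PW PM μ) : ℝ≥0∞) := by
  have hδ : 0 < 1 - ε := by linarith
  refine ⟨(1 - ε) ^ 2 / 36864, by positivity, ⌈282 / (1 - ε)⌉₊, fun n hn μ => ?_⟩
  have hn' : 282 ≤ (1 - ε) * n := by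
    have := (div_le_iff₀ hδ).1 (Nat.ceil_le.1 hn)
    linarith
  -- `k` has to satisfy `2 * k < (1 - ε) * n`, as up to `2 * k` couples may survive, and `k ^ 2`
  -- has to be of order `n ^ 2`; `46 ^ 2 ≥ 2048` makes the disjointness bound effective.
  set k := ⌊(1 - ε) * n / 3⌋₊ with hkdef
  have hk1 : (k : ℝ) ≤ (1 - ε) * n / 3 := Nat.floor_le (by positivity)
  have hk2 : (1 - ε) * n / 3 < k + 1 := Nat.lt_floor_add_one _
  have hk46 : 46 ≤ k := Nat.le_floor (by push_cast; linarith)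
  have hk6 : (1 - ε) * n / 6 ≤ k := by linarith
  have hbound : (1 - ε) ^ 2 / 36864 * (n : ℝ) ^ 2 ≤ (k : ℝ) ^ 2 / 1024 := by
    have := pow_le_pow_left₀ (by positivity) hk6 2
    linear_combination this / 1024
  have hcc : ((⌈(1 - ε) ^ 2 / 36864 * (n : ℝ) ^ 2⌉₊ : ℕ) : ℕ∞) ≤ randomizedCC
      (fun (PW : FullProfile (Fin n) (Fin n)) (PM : FullProfile (Fin n) (Fin n)) =>
        IsStable PW PM μ)
      (fun (PW : FullProfile (Fin n) (Fin n)) (PM : FullProfile (Fin n) (Fin n)) =>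
        IsEpsUnstable ε PW PM μ) := by
    refine le_iInf₂ fun P hP => ?_
    by_cases htop : P.cost (fun PW PM => IsStable PW PM μ ∨ IsEpsUnstable ε PW PM μ) = ⊤
    · exact htop ▸ le_top
    · obtain ⟨d, hd⟩ := ENat.ne_top_iff_exists.1 htop
      rw [← hd, Nat.cast_le]
      exact Nat.ceil_le.2 (hbound.trans (sq_div_le_of_cost_le hε0 (by linarith) hk46 μ P hP hd.ge))
  calc ENNReal.ofReal ((1 - ε) ^ 2 / 36864 * (n : ℝ) ^ 2)
      ≤ ((⌈(1 - ε) ^ 2 / 36864 * (n : ℝ) ^ 2⌉₊ : ℕ) : ℝ≥0∞) := by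
        rw [ENNReal.ofReal_le_natCast]
        exact Nat.le_ceil _
    _ ≤ _ := by
        rw [← ENat.toENNReal_coe]
        exact ENat.toENNReal_le.2 hcc
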